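/- Let $G,c>0$, let $\alpha\in C^2((0,\infty))$, and define the cumulative mass function $m:(0,\infty)\to\mathbb{R}$ by $$e^{2\alpha(r)} = 1-\frac{2Gm(r)}{c^2 r}\qquad (r>0).$$ On $\mathbb{R}\times(\mathbb{R}^3\setminus\{0\})$, with Cartesian coordinates $(t,x^1,x^2,x^3)$ and spherical coordinates $(t,r,\theta,\phi)$, consider the static spherically symmetric Lorentzian metric $$\mathbf g=-e^{2\alpha(r)}c^2\,dt^2+e^{-2\alpha(r)}\,dr^2+r^2\,(d\theta^2+\sin^2\theta\,d\phi^2),$$ with Levi-Civita connection $\nabla$, Einstein tensor $G^\mu{}_\nu=R^\mu{}_\nu-\tfrac12 R\,\delta^\mu{}_\nu$ and volume element $d\mathrm{vol}_{\mathbf g}$. Suppose that for some $\gamma>0$ $$m'(r)=O_1(r^{-1+\gamma})\qquad\text{as } r\downarrow 0,$$ that is, $r^{1-\gamma}m'(r)$ and $r^{2-\gamma}m''(r)$ are bounded as $r\downarrow0$. Then the twice-contracted second Bianchi identity holds weakly on all of $\mathbb{R}^4$: for every smooth compactly supported vector field $\psi$ on $\mathbb{R}^4$ the function $G^\mu{}_\nu\nabla_\mu\psi^\nu$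 is integrable with respect to $d\mathrm{vol}_{\mathbf g}$, and $$\int_{\mathbb{R}^4} G^\mu{}_\nu\,\nabla_\mu\psi^\nu\,d\mathrm{vol}_{\mathbf g}=0.$$ -/

import Mathlib

open scoped ContDiff Topology

namespace LorentzR4

noncomputable section

/-! ### Tensor calculus in the global coordinates `(t, x¹, x², x³)` of `ℝ⁴`

A (possibly singular) metric on `ℝ⁴` is given by its matrix of components at every point. -/

/-- The partial derivative `∂ᵢ f` at `x`. -/
def pderiv (i : Fin 4) (f : (Fin 4 → ℝ) → ℝ) (x : Fin 4 → ℝ) : ℝ :=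
  fderiv ℝ f x (Pi.single i 1)

/-- The Christoffel symbol `Γᵏᵢⱼ = ½ gᵏˡ (∂ᵢ gₗⱼ + ∂ⱼ gᵢₗ - ∂ₗ gᵢⱼ)` of the Levi-Civita
connection. -/
def christoffel (g : (Fin 4 → ℝ) → Matrix (Fin 4) (Fin 4) ℝ) (k i j : Fin 4)
    (x : Fin 4 → ℝ) : ℝ :=
  (1 / 2) * ∑ l, (g x)⁻¹ k l *
    (pderiv i (fun y => g y l j) x + pderiv j (fun y => g y i l) x
      - pderiv l (fun y => g y i j) x)

/-- The Ricci tensor `Rᵢⱼ = ∂ₖ Γᵏᵢⱼ - ∂ⱼ Γᵏᵢₖ + Γᵏₖₗ Γˡᵢⱼ - Γᵏⱼₗ Γˡᵢₖ`. -/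
def ricci (g : (Fin 4 → ℝ) → Matrix (Fin 4) (Fin 4) ℝ) (i j : Fin 4) (x : Fin 4 → ℝ) : ℝ :=
  ∑ k, (pderiv k (christoffel g k i j) x - pderiv j (christoffel g k i k) x
    + ∑ l, (christoffel g k k l x * christoffel g l i j x
      - christoffel g k j l x * christoffel g l i k x))

/-- The scalar curvature `R = gⁱʲ Rᵢⱼ`. -/
def scalarCurvature (g : (Fin 4 → ℝ) → Matrix (Fin 4) (Fin 4) ℝ) (x : Fin 4 → ℝ) : ℝ :=
  ∑ i, ∑ j, (g x)⁻¹ i j * ricci g i j x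

/-- The mixed Einstein tensor `Gᵘᵥ = Rᵘᵥ - ½ R δᵘᵥ`. -/
def einstein (g : (Fin 4 → ℝ) → Matrix (Fin 4) (Fin 4) ℝ) (μ ν : Fin 4) (x : Fin 4 → ℝ) : ℝ :=
  ∑ l, (g x)⁻¹ μ l * ricci g l ν x
    - (1 / 2) * scalarCurvature g x * (if μ = ν then 1 else 0)

/-- The covariant derivative `∇ᵤ ψᵛ = ∂ᵤ ψᵛ + Γᵛᵤₗ ψˡ` of a vector field `ψ`. -/
def covDeriv (g : (Fin 4 → ℝ) → Matrix (Fin 4) (Fin 4) ℝ) (ψ : (Fin 4 → ℝ) → (Fin 4 → ℝ))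
    (μ ν : Fin 4) (x : Fin 4 → ℝ) : ℝ :=
  pderiv μ (fun y => ψ y ν) x + ∑ l, christoffel g ν μ l x * ψ x l

/-- The density `√|det g|` of the volume element of `g` with respect to Lebesgue measure. -/
def volDensity (g : (Fin 4 → ℝ) → Matrix (Fin 4) (Fin 4) ℝ) (x : Fin 4 → ℝ) : ℝ :=
  Real.sqrt |(g x).det|

/-- The twice-contracted second Bianchi identity holds weakly on all of `ℝ⁴`: for every smooth
compactly supported vector field `ψ` on `ℝ⁴` the integral `∫ Gᵘᵥ ∇ᵤ ψᵛ dvol_g` exists as a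
Lebesgue integral and vanishes. -/
def WeakSecondBianchi (g : (Fin 4 → ℝ) → Matrix (Fin 4) (Fin 4) ℝ) : Prop :=
  ∀ ψ : (Fin 4 → ℝ) → (Fin 4 → ℝ), ContDiff ℝ ∞ ψ → HasCompactSupport ψ →
    MeasureTheory.Integrable
      (fun x => (∑ μ, ∑ ν, einstein g μ ν x * covDeriv g ψ μ ν x) * volDensity g x) ∧
    ∫ x, (∑ μ, ∑ ν, einstein g μ ν x * covDeriv g ψ μ ν x) * volDensity g x = 0

/-! ### Static spherically symmetric metrics -/

/-- The spatial radius `r = √((x¹)² + (x²)² + (x³)²)`; the coordinate `x 0` is the time `t`. -/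
def radius (x : Fin 4 → ℝ) : ℝ := Real.sqrt (x 1 ^ 2 + x 2 ^ 2 + x 3 ^ 2)

/-- The components of the one-form `dt`. -/
def dt (i : Fin 4) : ℝ := if i = 0 then 1 else 0

/-- The components of the one-form `dr = ∑ xⁱ dxⁱ / r` (for `r > 0`). -/
def dr (x : Fin 4 → ℝ) (i : Fin 4) : ℝ := if i = 0 then 0 else x i / radius x

/-- The components of the Euclidean metric `(dx¹)² + (dx²)² + (dx³)²` of space. -/
def euclid (i j : Fin 4) : ℝ := if i = j ∧ i ≠ 0 then 1 else 0

/-- The metric `-e^{2α(r)} c² dt² + e^{2β(r)} dr² + r² (dθ² + sin² θ dφ²)` for `r > 0`. Here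
`r² (dθ² + sin² θ dφ²) = (dx¹)² + (dx²)² + (dx³)² - dr²`. The values on the axis `r = 0`, a null
set off which the metric is defined, are irrelevant. -/
def staticMetric (c : ℝ) (α β : ℝ → ℝ) (x : Fin 4 → ℝ) : Matrix (Fin 4) (Fin 4) ℝ :=
  Matrix.of fun i j =>
    -(Real.exp (2 * α (radius x)) * c ^ 2) * (dt i * dt j)
      + Real.exp (2 * β (radius x)) * (dr x i * dr x j)
      + (euclid i j - dr x i * dr x j)

/-! ### Decay with derivatives -/

/-- `f(r) = O_k(r^a)` as `r ↓ 0`: the function `r^{j - a} f⁽ʲ⁾(r)` is bounded as `r ↓ 0` for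
`j = 0, …, k`. -/
def IsBigOWithDerivs (k : ℕ) (f : ℝ → ℝ) (a : ℝ) : Prop :=
  ∀ j ≤ k, (fun r : ℝ => r ^ ((j : ℝ) - a) * iteratedDeriv j f r) =O[𝓝[>] 0]
    (fun _ => (1 : ℝ))

end

end LorentzR4

/-!
Off the axis `r = 0` the Einstein tensor is `E / r²` on the span of `∂ₜ` and `∂ᵣ` and `E' / (2 r)`
on the spheres, where `E = (r (e^{2α} - 1))' = -(2 G / c²) m'`, and the volume density is
constant. The connection terms drop out of the contraction with `∇ψ`, because `Gᵗₜ = Gʳᵣ` and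
`Γᵗₜᵣ + Γʳᵣᵣ = 0`. What is left is a constant multiple of the Euclidean divergence of `Z(r) F`,
where `Z = E / r²` and `F` is a smooth compactly supported vector field that does not depend on
the metric. The terms of this divergence are `O(r^{γ - 3})`, hence locally integrable. As almost
every coordinate line misses the axis, which has codimension three, Fubini's theorem shows that
each `∂ₖ (Z(r) Fᵏ)` has integral zero, without any cutoff near the axis.
-/

namespace LorentzR4

/-- `f` is differentiable at `x` with partial derivatives `v i`. Differentiability is recorded
because `pderiv` takes the junk value `0` without it. -/
structure HasPartialsAt (f : (Fin 4 → ℝ) → ℝ) (v x : Fin 4 → ℝ) : Prop where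
  differentiableAt : DifferentiableAt ℝ f x
  pderiv_eq : ∀ i, pderiv i f x = v i

namespace HasPartialsAt

variable {f g : (Fin 4 → ℝ) → ℝ} {v w x : Fin 4 → ℝ}

theorem congr_partials (hf : HasPartialsAt f v x) (h : ∀ i, v i = w i) : HasPartialsAt f w x :=
  ⟨hf.differentiableAt, fun i => (hf.pderiv_eq i).trans (h i)⟩

theorem congr_of_eventuallyEq (hf : HasPartialsAt f v x) (h : g =ᶠ[𝓝 x] f) :
    HasPartialsAt g v x :=
  ⟨hf.differentiableAt.congr_of_eventuallyEq h, fun i => by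
    rw [← hf.pderiv_eq, pderiv, pderiv, h.fderiv_eq]⟩

theorem const (a : ℝ) : HasPartialsAt (fun _ => a) (fun _ => 0) x :=
  ⟨differentiableAt_const a, fun i => by simp [pderiv]⟩

theorem add (hf : HasPartialsAt f v x) (hg : HasPartialsAt g w x) :
    HasPartialsAt (fun y => f y + g y) (fun i => v i + w i) x :=
  ⟨hf.differentiableAt.fun_add hg.differentiableAt, fun i => by
    rw [← hf.pderiv_eq, ← hg.pderiv_eq, pderiv,
      fderiv_fun_add hf.differentiableAt hg.differentiableAt]; rfl⟩

theorem mul (hf : HasPartialsAt f v x) (hg : HasPartialsAt g w x) :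
    HasPartialsAt (fun y => f y * g y) (fun i => f x * w i + g x * v i) x :=
  ⟨hf.differentiableAt.fun_mul hg.differentiableAt, fun i => by
    rw [← hf.pderiv_eq, ← hg.pderiv_eq, pderiv,
      fderiv_fun_mul hf.differentiableAt hg.differentiableAt]; rfl⟩

theorem comp {ζ : ℝ → ℝ} {d : ℝ} (hζ : HasDerivAt ζ d (f x)) (hf : HasPartialsAt f v x) :
    HasPartialsAt (fun y => ζ (f y)) (fun i => d * v i) x := by
  have h := hζ.comp_hasFDerivAt x hf.differentiableAt.hasFDerivAt
  exact ⟨h.differentiableAt, fun i => by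
    rw [← hf.pderiv_eq]; exact congrArg (· (Pi.single i 1)) h.fderiv⟩

theorem coord (j : Fin 4) (x : Fin 4 → ℝ) :
    HasPartialsAt (fun y => y j) (fun i => if i = j then 1 else 0) x := by
  refine ⟨by fun_prop, fun i => ?_⟩
  have h : HasFDerivAt (fun y : Fin 4 → ℝ => y j)
    (ContinuousLinearMap.proj (R := ℝ) (φ := fun _ : Fin 4 => ℝ) j) x := hasFDerivAt_apply j x
  simp [pderiv, h.fderiv, Pi.single_apply, eq_comm]

end HasPartialsAt

theorem pderiv_sum {ι : Type*} {s : Finset ι} {f : ι → (Fin 4 → ℝ) → ℝ} {x : Fin 4 → ℝ}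
    (hf : ∀ k ∈ s, DifferentiableAt ℝ (f k) x) (i : Fin 4) :
    pderiv i (fun y => ∑ k ∈ s, f k y) x = ∑ k ∈ s, pderiv i (f k) x := by
  rw [pderiv, fderiv_fun_sum hf, sum_apply]; rfl

theorem radius_sq (x : Fin 4 → ℝ) : radius x ^ 2 = x 1 ^ 2 + x 2 ^ 2 + x 3 ^ 2 :=
  Real.sq_sqrt (by positivity)

theorem continuous_radius : Continuous radius := by
  unfold radius; fun_prop

theorem eventually_radius_pos {x : Fin 4 → ℝ} (hx : 0 < radius x) : ∀ᶠ y in 𝓝 x, 0 < radius y :=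
  continuous_radius.continuousAt.eventually (lt_mem_nhds hx)

theorem dr_time (x : Fin 4 → ℝ) : dr x 0 = 0 := rfl

theorem radius_mul_dr {x : Fin 4 → ℝ} (hx : 0 < radius x) {i : Fin 4} (hi : i ≠ 0) :
    radius x * dr x i = x i := by
  rw [dr, if_neg hi, mul_div_cancel₀ _ hx.ne']

theorem sum_dr_sq {x : Fin 4 → ℝ} (hx : 0 < radius x) :
    dr x 1 ^ 2 + dr x 2 ^ 2 + dr x 3 ^ 2 = 1 := by
  have : dr x 1 ^ 2 + dr x 2 ^ 2 + dr x 3 ^ 2 = (x 1 ^ 2 + x 2 ^ 2 + x 3 ^ 2) / radius x ^ 2 := by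
    simp only [dr, Fin.reduceEq, if_false]; ring
  rw [this, ← radius_sq, div_self (by positivity)]

/-- The orthogonal projection `dx² - dr²` onto the directions tangent to the spheres `r = const`;
the metric of the unit sphere is `r⁻²` times it. -/
noncomputable def sphereProj (x : Fin 4 → ℝ) : Matrix (Fin 4) (Fin 4) ℝ :=
  Matrix.of fun i j => euclid i j - dr x i * dr x j

theorem hasPartialsAt_radius {x : Fin 4 → ℝ} (hx : 0 < radius x) :
    HasPartialsAt radius (dr x) x := by
  have hsq := (((HasPartialsAt.coord 1 x).comp (hasDerivAt_pow 2 _)).add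
    ((HasPartialsAt.coord 2 x).comp (hasDerivAt_pow 2 _))).add
    ((HasPartialsAt.coord 3 x).comp (hasDerivAt_pow 2 _))
  have hne : x 1 ^ 2 + x 2 ^ 2 + x 3 ^ 2 ≠ 0 := by rw [← radius_sq]; positivity
  refine (hsq.comp (Real.hasDerivAt_sqrt hne)).congr_partials fun i => ?_
  change 1 / (2 * radius x) * _ = _
  fin_cases i <;> simp [dr] <;> field

theorem HasPartialsAt.radial {ζ : ℝ → ℝ} {d r : ℝ} {x : Fin 4 → ℝ} (hx : radius x = r)
    (hr : 0 < r) (hζ : HasDerivAt ζ d r) :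
    HasPartialsAt (fun y => ζ (radius y)) (fun i => d * dr x i) x := by
  subst hx
  exact (hasPartialsAt_radius hr).comp hζ

theorem hasPartialsAt_dr {x : Fin 4 → ℝ} (hx : 0 < radius x) (j : Fin 4) :
    HasPartialsAt (fun y => dr y j) (fun i => sphereProj x i j / radius x) x := by
  obtain rfl | hj := eq_or_ne j 0
  · exact (HasPartialsAt.const 0).congr_partials fun i => by simp [sphereProj, euclid, dr_time]
  · have h := (HasPartialsAt.coord j x).mul (.radial rfl hx (hasDerivAt_inv hx.ne'))
    simp only [dr, if_neg hj]
    refine h.congr_partials fun i => ?_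
    have hδ : euclid i j = if i = j then 1 else 0 := by simp only [euclid]; grind
    rw [sphereProj, Matrix.of_apply, hδ, ← radius_mul_dr hx hj]
    field

section Frame

open Matrix

variable {x : Fin 4 → ℝ}

theorem sphereProj_time (j : Fin 4) : sphereProj x 0 j = 0 := by
  simp [sphereProj, euclid, dr_time]

theorem sphereProj_comm (i j : Fin 4) : sphereProj x i j = sphereProj x j i := by
  simp only [sphereProj, euclid, Matrix.of_apply]; grind

theorem sphereProj_eq_one_sub :
    sphereProj x = 1 - vecMulVec dt dt - vecMulVec (dr x) (dr x) := by
  ext i j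
  simp only [sphereProj, euclid, dt, Matrix.of_apply, Matrix.sub_apply, vecMulVec_apply,
    Matrix.one_apply]
  grind

theorem dt_dotProduct_dr : dt ⬝ᵥ dr x = 0 := by simp [dotProduct, dt, dr_time]

theorem dr_dotProduct_dr (hx : 0 < radius x) : dr x ⬝ᵥ dr x = 1 := by
  simp only [dotProduct, Fin.sum_univ_four, dr_time, ← sum_dr_sq hx]; ring

theorem dt_dotProduct_dt : dt ⬝ᵥ dt = 1 := by simp [dotProduct, dt]

theorem dr_dotProduct_dt : dr x ⬝ᵥ dt = 0 := by rw [dotProduct_comm, dt_dotProduct_dr]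

theorem sphereProj_mulVec_dt : sphereProj x *ᵥ dt = 0 := by
  simp [sphereProj_eq_one_sub, sub_mulVec, vecMulVec_mulVec, dt_dotProduct_dt, dr_dotProduct_dt]

theorem sphereProj_mulVec_dr (hx : 0 < radius x) : sphereProj x *ᵥ dr x = 0 := by
  simp [sphereProj_eq_one_sub, sub_mulVec, vecMulVec_mulVec, dr_dotProduct_dr hx, dt_dotProduct_dr]

theorem sphereProj_trace (hx : 0 < radius x) : (sphereProj x).trace = 2 := by
  rw [sphereProj_eq_one_sub, trace_sub, trace_sub, trace_one, trace_vecMulVec, trace_vecMulVec,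
    dt_dotProduct_dt, dr_dotProduct_dr hx]
  norm_num

/-- The tensor `a dt² + b dr² + e (dx² - dr²)`. Such tensors form a commutative algebra, with
componentwise operations on `(a, b, e)`. -/
noncomputable def frameMatrix (a b e : ℝ) (x : Fin 4 → ℝ) : Matrix (Fin 4) (Fin 4) ℝ :=
  a • vecMulVec dt dt + b • vecMulVec (dr x) (dr x) + e • sphereProj x

theorem frameMatrix_mul (hx : 0 < radius x) (a b e a' b' e' : ℝ) :
    frameMatrix a b e x * frameMatrix a' b' e' x = frameMatrix (a * a') (b * b') (e * e') x := by
  simp only [frameMatrix, sphereProj_eq_one_sub, mul_add, add_mul, mul_sub, sub_mul,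
    smul_mul_assoc, mul_smul_comm, vecMulVec_mul_vecMulVec, dt_dotProduct_dt, dr_dotProduct_dt,
    dt_dotProduct_dr, dr_dotProduct_dr hx, mul_one, one_mul, zero_smul, one_smul, vecMulVec_zero]
  module

theorem frameMatrix_one : frameMatrix 1 1 1 x = 1 := by
  rw [frameMatrix, sphereProj_eq_one_sub]; module

theorem frameMatrix_inv (hx : 0 < radius x) {a b e : ℝ} (ha : a ≠ 0) (hb : b ≠ 0) (he : e ≠ 0) :
    (frameMatrix a b e x)⁻¹ = frameMatrix a⁻¹ b⁻¹ e⁻¹ x := by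
  refine Matrix.inv_eq_right_inv ?_
  rw [frameMatrix_mul hx, mul_inv_cancel₀ ha, mul_inv_cancel₀ hb, mul_inv_cancel₀ he,
    frameMatrix_one]

theorem frameMatrix_trace (hx : 0 < radius x) (a b e : ℝ) :
    (frameMatrix a b e x).trace = a + b + 2 * e := by
  simp only [frameMatrix, trace_add, trace_smul, trace_vecMulVec, dt_dotProduct_dt,
    dr_dotProduct_dr hx, sphereProj_trace hx, smul_eq_mul]
  ring

theorem frameMatrix_det (hx : 0 < radius x) (a b : ℝ) : (frameMatrix a b 1 x).det = a * b := by
  have hsplit : frameMatrix a b 1 x =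
      (1 + vecMulVec ((a - 1) • dt) dt) * (1 + vecMulVec ((b - 1) • dr x) (dr x)) := by
    simp only [frameMatrix, sphereProj_eq_one_sub, mul_add, add_mul, mul_one, one_mul,
      vecMulVec_mul_vecMulVec, smul_vecMulVec, smul_mul_assoc, mul_smul_comm, dt_dotProduct_dr,
      zero_smul, vecMulVec_zero, smul_zero]
    module
  rw [hsplit, det_mul, vecMulVec_eq Unit, vecMulVec_eq Unit,
    det_one_add_replicateCol_mul_replicateRow, det_one_add_replicateCol_mul_replicateRow,
    dotProduct_smul, dotProduct_smul, dt_dotProduct_dt, dr_dotProduct_dr hx]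
  simp

theorem frameMatrix_mulVec_dt (a b e : ℝ) : frameMatrix a b e x *ᵥ dt = a • dt := by
  simp [frameMatrix, add_mulVec, smul_mulVec, vecMulVec_mulVec, dt_dotProduct_dt,
    dr_dotProduct_dt, sphereProj_mulVec_dt]

theorem frameMatrix_mulVec_dr (hx : 0 < radius x) (a b e : ℝ) :
    frameMatrix a b e x *ᵥ dr x = b • dr x := by
  simp [frameMatrix, add_mulVec, smul_mulVec, vecMulVec_mulVec, dt_dotProduct_dr,
    dr_dotProduct_dr hx, sphereProj_mulVec_dr hx]

end Frame

section Curvature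

open Matrix

variable {x : Fin 4 → ℝ} {r : ℝ}

theorem frameMatrix_apply (a b e : ℝ) (x : Fin 4 → ℝ) (i j : Fin 4) : frameMatrix a b e x i j =
    a * (dt i * dt j) + b * (dr x i * dr x j) + e * sphereProj x i j := by
  simp [frameMatrix, vecMulVec_apply]

theorem hasPartialsAt_sphereProj (hx : 0 < radius x) (i j : Fin 4) :
    HasPartialsAt (fun y => sphereProj y i j)
      (fun l => -(sphereProj x l i * dr x j + dr x i * sphereProj x l j) / radius x) x := by
  have h := (HasPartialsAt.const (euclid i j)).add
    (((hasPartialsAt_dr hx i).mul (hasPartialsAt_dr hx j)).mul (.const (-1)))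
  refine (h.congr_partials fun l => ?_).congr_of_eventuallyEq (.of_forall fun y => ?_)
  · ring
  · simp only [sphereProj, of_apply]; ring

theorem hasPartialsAt_frameMatrix {a b e : ℝ → ℝ} {a' b' e' : ℝ} (hx : radius x = r) (hr : 0 < r)
    (ha : HasDerivAt a a' r) (hb : HasDerivAt b b' r) (he : HasDerivAt e e' r) (i j : Fin 4) :
    HasPartialsAt (fun y => frameMatrix (a (radius y)) (b (radius y)) (e (radius y)) y i j)
      (fun l => dr x l * frameMatrix a' b' e' x i j
        + (b r - e r) / r * (sphereProj x l i * dr x j + dr x i * sphereProj x l j)) x := by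
  have hx₀ := hx ▸ hr
  have h := (((HasPartialsAt.radial hx hr ha).mul (.const (dt i * dt j))).add
    ((HasPartialsAt.radial hx hr hb).mul
      ((hasPartialsAt_dr hx₀ i).mul (hasPartialsAt_dr hx₀ j)))).add
    ((HasPartialsAt.radial hx hr he).mul (hasPartialsAt_sphereProj hx₀ i j))
  simp only [frameMatrix_apply]
  exact h.congr_partials fun l => by rw [hx]; ring

/-- The connection matrix `(k, j) ↦ Γᵏᵢⱼ` of a static spherically symmetric metric: `A` is `Γᵗₜᵣ`,
and `B`, `C`, `D` are the `dt²`, `dr²` and spherical components of `Γʳ`. -/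
noncomputable def connectionMatrix (A B C D : ℝ) (x : Fin 4 → ℝ) (i : Fin 4) :
    Matrix (Fin 4) (Fin 4) ℝ :=
  vecMulVec dt (A • (dt i • dr x + dr x i • dt)) + vecMulVec (dr x) (frameMatrix B C D x i)

theorem connectionMatrix_apply (A B C D : ℝ) (x : Fin 4 → ℝ) (i k j : Fin 4) :
    connectionMatrix A B C D x i k j =
      A * (dt k * (dt i * dr x j + dr x i * dt j)) + dr x k * frameMatrix B C D x i j := by
  simp only [connectionMatrix, Matrix.add_apply, vecMulVec_apply, Pi.add_apply, Pi.smul_apply,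
    smul_eq_mul]
  ring

theorem pderiv_frameMatrix {a b : ℝ → ℝ} {a' b' : ℝ} (hx : radius x = r) (hr : 0 < r)
    (ha : HasDerivAt a a' r) (hb : HasDerivAt b b' r) (l i j : Fin 4) :
    pderiv l (fun y => frameMatrix (a (radius y)) (b (radius y)) 1 y i j) x =
      dr x l * frameMatrix a' b' 0 x i j
        + (b r - 1) / r * (sphereProj x l i * dr x j + dr x i * sphereProj x l j) :=
  (hasPartialsAt_frameMatrix hx hr ha hb (hasDerivAt_const r 1) i j).pderiv_eq l

theorem sum_frameMatrix_mul (hx : 0 < radius x) (a b e u v : ℝ) (k : Fin 4) :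
    ∑ l, frameMatrix a b e x k l * (u * dt l + v * dr x l) = a * u * dt k + b * v * dr x k := by
  change (frameMatrix a b e x *ᵥ (u • dt + v • dr x)) k = _
  rw [mulVec_add, mulVec_smul, mulVec_smul, frameMatrix_mulVec_dt, frameMatrix_mulVec_dr hx]
  simp only [Pi.add_apply, Pi.smul_apply, smul_eq_mul]
  ring

theorem christoffel_frameMatrix {a b : ℝ → ℝ} {a' b' : ℝ} (hx : radius x = r) (hr : 0 < r)
    (ha : HasDerivAt a a' r) (hb : HasDerivAt b b' r) (ha₀ : a r ≠ 0) (hb₀ : b r ≠ 0)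
    (k i j : Fin 4) :
    christoffel (fun y => frameMatrix (a (radius y)) (b (radius y)) 1 y) k i j x =
      connectionMatrix (a' / (2 * a r)) (-a' / (2 * b r)) (b' / (2 * b r)) ((1 - (b r)⁻¹) / r)
        x i k j := by
  have hx₀ := hx ▸ hr
  have hlower : ∀ l, pderiv i (fun y => frameMatrix (a (radius y)) (b (radius y)) 1 y l j) x
      + pderiv j (fun y => frameMatrix (a (radius y)) (b (radius y)) 1 y i l) x
      - pderiv l (fun y => frameMatrix (a (radius y)) (b (radius y)) 1 y i j) x =
      (a' * (dt i * dr x j + dr x i * dt j)) * dt l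
        + frameMatrix (-a') b' (2 * ((b r - 1) / r)) x i j * dr x l := by
    intro l
    simp only [pderiv_frameMatrix hx hr ha hb]
    simp only [frameMatrix_apply, sphereProj_comm l, sphereProj_comm j i]
    ring
  simp only [christoffel, hlower]
  simp only [hx, frameMatrix_inv hx₀ ha₀ hb₀ one_ne_zero, sum_frameMatrix_mul hx₀]
  rw [connectionMatrix_apply, frameMatrix_apply, frameMatrix_apply]
  field

theorem frameMatrix_row_dotProduct_dt (a b e : ℝ) (x : Fin 4 → ℝ) (i : Fin 4) :
    frameMatrix a b e x i ⬝ᵥ dt = a * dt i :=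
  congrFun (frameMatrix_mulVec_dt a b e) i

theorem frameMatrix_row_dotProduct_dr (hx : 0 < radius x) (a b e : ℝ) (i : Fin 4) :
    frameMatrix a b e x i ⬝ᵥ dr x = b * dr x i :=
  congrFun (frameMatrix_mulVec_dr hx a b e) i

theorem connectionMatrix_trace (hx : 0 < radius x) (A B C D : ℝ) (i : Fin 4) :
    (connectionMatrix A B C D x i).trace = (A + C) * dr x i := by
  rw [connectionMatrix, trace_add, trace_vecMulVec, trace_vecMulVec, dotProduct_comm (dr x),
    frameMatrix_row_dotProduct_dr hx]
  simp only [dotProduct_smul, dotProduct_add, dt_dotProduct_dr, dt_dotProduct_dt, smul_eq_mul]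
  ring

theorem connectionMatrix_comm (A B C D : ℝ) (x : Fin 4 → ℝ) (i k j : Fin 4) :
    connectionMatrix A B C D x i k j = connectionMatrix A B C D x j k i := by
  simp only [connectionMatrix_apply, frameMatrix_apply, sphereProj_comm i j]; ring

theorem sum_connectionMatrix_mul (hx : 0 < radius x) (A B C D : ℝ) (i j : Fin 4) :
    ∑ k, ∑ l, connectionMatrix A B C D x k k l * connectionMatrix A B C D x i l j =
      (A + C) * frameMatrix B C D x i j := by
  have htn : ∑ l, dr x l * dt l = 0 := dr_dotProduct_dt
  have hnn : ∑ l, dr x l * dr x l = 1 := dr_dotProduct_dr hx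
  calc ∑ k, ∑ l, connectionMatrix A B C D x k k l * connectionMatrix A B C D x i l j
      = ∑ l, (connectionMatrix A B C D x l).trace * connectionMatrix A B C D x i l j := by
        rw [Finset.sum_comm]
        simp only [connectionMatrix_comm _ _ _ _ x _ _, ← Finset.sum_mul]; rfl
    _ = (A + C) * A * (dt i * dr x j + dr x i * dt j) * ∑ l, dr x l * dt l
          + (A + C) * frameMatrix B C D x i j * ∑ l, dr x l * dr x l := by
        simp only [connectionMatrix_trace hx, connectionMatrix_apply, Finset.mul_sum,
          ← Finset.sum_add_distrib]
        exact Finset.sum_congr rfl fun l _ => by ring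
    _ = _ := by rw [htn, hnn]; ring

theorem connectionMatrix_mul_trace (hx : 0 < radius x) (A B C D : ℝ) (i j : Fin 4) :
    (connectionMatrix A B C D x j * connectionMatrix A B C D x i).trace =
      frameMatrix (2 * A * B) (A ^ 2 + C ^ 2) 0 x i j := by
  have htrace : ∀ u v u' v' : Fin 4 → ℝ,
      ((vecMulVec dt u + vecMulVec (dr x) v) * (vecMulVec dt u' + vecMulVec (dr x) v')).trace =
      (u ⬝ᵥ dt) * (u' ⬝ᵥ dt) + (u ⬝ᵥ dr x) * (v' ⬝ᵥ dt) + (v ⬝ᵥ dt) * (u' ⬝ᵥ dr x)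
        + (v ⬝ᵥ dr x) * (v' ⬝ᵥ dr x) := by
    intro u v u' v'
    simp only [add_mul, mul_add, vecMulVec_mul_vecMulVec, trace_add, trace_vecMulVec,
      dotProduct_smul, smul_eq_mul, dotProduct_comm u', dotProduct_comm v']
    ring
  simp only [connectionMatrix, htrace, frameMatrix_row_dotProduct_dt,
    frameMatrix_row_dotProduct_dr hx, smul_dotProduct, add_dotProduct, dt_dotProduct_dt,
    dt_dotProduct_dr, dr_dotProduct_dt, dr_dotProduct_dr hx, smul_eq_mul, frameMatrix_apply]
  ring

theorem hasPartialsAt_connectionMatrix {A B C D : ℝ → ℝ} {A' B' C' D' : ℝ} (hx : radius x = r)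
    (hr : 0 < r) (hA : HasDerivAt A A' r) (hB : HasDerivAt B B' r) (hC : HasDerivAt C C' r)
    (hD : HasDerivAt D D' r) (i k j : Fin 4) :
    HasPartialsAt (fun y =>
        connectionMatrix (A (radius y)) (B (radius y)) (C (radius y)) (D (radius y)) y i k j)
      (fun l => dr x l * connectionMatrix A' B' C' D' x i k j
        + (A r * dt k * (dt i * sphereProj x l j + sphereProj x l i * dt j)
          + sphereProj x l k * frameMatrix (B r) (C r) (D r) x i j
          + (C r - D r) * dr x k * (sphereProj x l i * dr x j + dr x i * sphereProj x l j)) / r)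
      x := by
  have hx₀ := hx ▸ hr
  have hdr := hasPartialsAt_dr hx₀
  have h := ((HasPartialsAt.radial hx hr hA).mul ((HasPartialsAt.const (dt k)).mul
    (((HasPartialsAt.const (dt i)).mul (hdr j)).add ((hdr i).mul (.const (dt j)))))).add
    ((hdr k).mul (hasPartialsAt_frameMatrix hx hr hB hC hD i j))
  simp only [connectionMatrix_apply]
  exact h.congr_partials fun l => by rw [hx]; field

theorem sum_pderiv_connectionMatrix {A B C D : ℝ → ℝ} {A' B' C' D' : ℝ} (hx : radius x = r)
    (hr : 0 < r) (hA : HasDerivAt A A' r) (hB : HasDerivAt B B' r) (hC : HasDerivAt C C' r)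
    (hD : HasDerivAt D D' r) (i j : Fin 4) :
    ∑ k, pderiv k (fun y =>
        connectionMatrix (A (radius y)) (B (radius y)) (C (radius y)) (D (radius y)) y i k j) x =
      frameMatrix (B' + 2 * B r / r) (C' + 2 * C r / r) (D' + 2 * D r / r) x i j := by
  have hx₀ := hx ▸ hr
  have hframe : frameMatrix (B' + 2 * B r / r) (C' + 2 * C r / r) (D' + 2 * D r / r) x i j =
      frameMatrix B' C' D' x i j + 2 / r * frameMatrix (B r) (C r) (D r) x i j := by
    simp only [frameMatrix_apply]; ring
  have htn : ∑ k, dt k * dr x k = 0 := dt_dotProduct_dr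
  have hnn : ∑ k, dr x k * dr x k = 1 := dr_dotProduct_dr hx₀
  have htrace : ∑ k, sphereProj x k k = 2 := sphereProj_trace hx₀
  have hPt : ∀ j, ∑ k, sphereProj x k j * dt k = 0 := fun j => by
    simp only [sphereProj_comm _ j]; exact congrFun sphereProj_mulVec_dt j
  have hPn : ∀ j, ∑ k, sphereProj x k j * dr x k = 0 := fun j => by
    simp only [sphereProj_comm _ j]; exact congrFun (sphereProj_mulVec_dr hx₀) j
  simp only [(hasPartialsAt_connectionMatrix hx hr hA hB hC hD i _ j).pderiv_eq]
  simp only [hframe, connectionMatrix_apply, Fin.sum_univ_four] at *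
  linear_combination A' * (dt i * dr x j + dr x i * dt j) * htn
    + frameMatrix B' C' D' x i j * hnn + frameMatrix (B r) (C r) (D r) x i j / r * htrace
    + A r / r * (dt i * hPt j + dt j * hPt i) + (C r - D r) / r * (dr x j * hPn i + dr x i * hPn j)

theorem sum_pderiv_connectionMatrix_diag {A B C D : ℝ → ℝ} {A' B' C' D' : ℝ} (hx : radius x = r)
    (hr : 0 < r) (hA : HasDerivAt A A' r) (hB : HasDerivAt B B' r) (hC : HasDerivAt C C' r)
    (hD : HasDerivAt D D' r) (i j : Fin 4) :
    ∑ k, pderiv j (fun y =>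
        connectionMatrix (A (radius y)) (B (radius y)) (C (radius y)) (D (radius y)) y i k k) x =
      frameMatrix 0 (A' + C') ((A r + C r) / r) x i j := by
  have hx₀ := hx ▸ hr
  have htrace := ((HasPartialsAt.radial hx hr (hA.add hC)).mul
    (hasPartialsAt_dr hx₀ i)).congr_of_eventuallyEq <| (eventually_radius_pos hx₀).mono fun y hy =>
      connectionMatrix_trace hy (A (radius y)) (B (radius y)) (C (radius y)) (D (radius y)) i
  have hdiff := fun k (_ : k ∈ Finset.univ) =>
    (hasPartialsAt_connectionMatrix hx hr hA hB hC hD i k k).differentiableAt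
  exact (pderiv_sum hdiff j).symm.trans (htrace.pderiv_eq j) |>.trans <| by
    simp only [frameMatrix_apply, hx, sphereProj_comm j i, Pi.add_apply]
    ring

theorem ricci_of_christoffel_eq_connectionMatrix
    {g : (Fin 4 → ℝ) → Matrix (Fin 4) (Fin 4) ℝ} {A B C D : ℝ → ℝ} {A' B' C' D' : ℝ}
    (hx : radius x = r) (hr : 0 < r)
    (hΓ : ∀ k i j y, 0 < radius y → christoffel g k i j y =
      connectionMatrix (A (radius y)) (B (radius y)) (C (radius y)) (D (radius y)) y i k j)
    (hA : HasDerivAt A A' r) (hB : HasDerivAt B B' r) (hC : HasDerivAt C C' r)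
    (hD : HasDerivAt D D' r) (i j : Fin 4) :
    ricci g i j x =
      frameMatrix (B' + 2 * B r / r + (C r - A r) * B r)
        (2 * C r / r - A' + A r * C r - A r ^ 2)
        (D' + 2 * D r / r + (A r + C r) * (D r - 1 / r)) x i j := by
  have hx₀ := hx ▸ hr
  have hpderiv : ∀ l k i j, pderiv l (christoffel g k i j) x = pderiv l (fun y =>
      connectionMatrix (A (radius y)) (B (radius y)) (C (radius y)) (D (radius y)) y i k j) x := by
    intro l k i j
    rw [pderiv, pderiv, Filter.EventuallyEq.fderiv_eq]
    exact (eventually_radius_pos hx₀).mono (hΓ k i j)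
  have hquad : ∑ k, ∑ l, christoffel g k j l x * christoffel g l i k x =
      frameMatrix (2 * A r * B r) (A r ^ 2 + C r ^ 2) 0 x i j := by
    simp only [hΓ _ _ _ x hx₀, hx, ← connectionMatrix_mul_trace hx₀ (A r) (B r) (C r) (D r) i j]
    simp only [trace, diag, mul_apply]
  have htr : ∑ k, ∑ l, christoffel g k k l x * christoffel g l i j x =
      (A r + C r) * frameMatrix (B r) (C r) (D r) x i j := by
    simp only [hΓ _ _ _ x hx₀, hx]
    exact sum_connectionMatrix_mul hx₀ (A r) (B r) (C r) (D r) i j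
  simp only [ricci, Finset.sum_add_distrib, Finset.sum_sub_distrib, hpderiv, hquad, htr,
    sum_pderiv_connectionMatrix hx hr hA hB hC hD,
    sum_pderiv_connectionMatrix_diag hx hr hA hB hC hD, frameMatrix_apply]
  ring

end Curvature

section StaticMetric

open Matrix

variable {c r : ℝ} {α β : ℝ → ℝ} {x : Fin 4 → ℝ}

theorem einstein_of_ricci_eq_frameMatrix {g : (Fin 4 → ℝ) → Matrix (Fin 4) (Fin 4) ℝ}
    {a b p q s : ℝ} (hx : 0 < radius x) (ha : a ≠ 0) (hb : b ≠ 0) (hg : g x = frameMatrix a b 1 x)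
    (hric : ∀ i j, ricci g i j x = frameMatrix p q s x i j) (μ ν : Fin 4) :
    einstein g μ ν x =
      frameMatrix ((p / a - q / b) / 2 - s) ((q / b - p / a) / 2 - s) (-(p / a + q / b) / 2)
        x μ ν := by
  have hraise : ∀ μ ν, ∑ l, (g x)⁻¹ μ l * ricci g l ν x = frameMatrix (p / a) (q / b) s x μ ν := by
    intro μ ν
    simp only [hric, hg, frameMatrix_inv hx ha hb one_ne_zero, ← mul_apply, frameMatrix_mul hx]
    congr 1 <;> ring
  have hsymm : ∀ i j, ricci g i j x = ricci g j i x := by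
    intro i j; simp only [hric, frameMatrix_apply, sphereProj_comm i j]; ring
  have hscalar : scalarCurvature g x = p / a + q / b + 2 * s := by
    rw [← frameMatrix_trace hx]
    simp only [scalarCurvature, trace, diag, ← hraise, hsymm]
  have hδ : (if μ = ν then (1 : ℝ) else 0) = frameMatrix 1 1 1 x μ ν := by
    rw [frameMatrix_one, one_apply]
  rw [einstein, hraise, hscalar, hδ]
  simp only [frameMatrix_apply]
  ring

theorem sum_frameMatrix_mul_connectionMatrix (hx : 0 < radius x) (a b e A B C D : ℝ) (l : Fin 4) :
    ∑ μ, ∑ ν, frameMatrix a b e x μ ν * connectionMatrix A B C D x μ ν l =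
      (a * A + b * C) * dr x l := by
  simp only [connectionMatrix_comm A B C D x _ _ l]
  change (frameMatrix a b e x * connectionMatrix A B C D x l).trace = _
  rw [connectionMatrix, mul_add, mul_vecMulVec, mul_vecMulVec, frameMatrix_mulVec_dt,
    frameMatrix_mulVec_dr hx, trace_add, trace_vecMulVec, trace_vecMulVec, smul_dotProduct,
    smul_dotProduct, dotProduct_comm (dr x), frameMatrix_row_dotProduct_dr hx]
  simp only [dotProduct_smul, dotProduct_add, dt_dotProduct_dr, dt_dotProduct_dt, smul_eq_mul]
  ring

theorem sum_frameMatrix_mul_covDeriv {g : (Fin 4 → ℝ) → Matrix (Fin 4) (Fin 4) ℝ}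
    {A B C D : ℝ} (hx : 0 < radius x)
    (hΓ : ∀ k i j, christoffel g k i j x = connectionMatrix A B C D x i k j) (a b e : ℝ)
    (ψ : (Fin 4 → ℝ) → Fin 4 → ℝ) :
    ∑ μ, ∑ ν, frameMatrix a b e x μ ν * covDeriv g ψ μ ν x =
      ∑ μ, ∑ ν, frameMatrix a b e x μ ν * pderiv μ (fun y => ψ y ν) x
        + (a * A + b * C) * ∑ l, dr x l * ψ x l := by
  have hswap : ∑ μ, ∑ ν, frameMatrix a b e x μ ν * ∑ l, connectionMatrix A B C D x μ ν l * ψ x l =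
      ∑ l, (∑ μ, ∑ ν, frameMatrix a b e x μ ν * connectionMatrix A B C D x μ ν l) * ψ x l := by
    simp only [Finset.mul_sum, Finset.sum_mul, mul_assoc]
    exact Finset.sum_comm_cycle
  simp only [covDeriv, hΓ, mul_add, Finset.sum_add_distrib]
  rw [hswap]
  simp only [sum_frameMatrix_mul_connectionMatrix hx, mul_assoc, ← Finset.mul_sum]

theorem staticMetric_eq_frameMatrix (c : ℝ) (α β : ℝ → ℝ) (x : Fin 4 → ℝ) :
    staticMetric c α β x =
      frameMatrix (-(Real.exp (2 * α (radius x)) * c ^ 2)) (Real.exp (2 * β (radius x))) 1 x := by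
  ext i j
  rw [frameMatrix_apply, one_mul]
  rfl

theorem volDensity_staticMetric (hx : 0 < radius x) (c : ℝ) (α β : ℝ → ℝ) :
    volDensity (staticMetric c α β) x = |c| * Real.exp (α (radius x) + β (radius x)) := by
  have hdet :
      |(staticMetric c α β x).det| = (|c| * Real.exp (α (radius x) + β (radius x))) ^ 2 := by
    rw [staticMetric_eq_frameMatrix, frameMatrix_det hx, neg_mul, abs_neg,
      abs_of_nonneg (by positivity), mul_pow, sq_abs, ← Real.exp_nat_mul, Nat.cast_ofNat, mul_add,
      Real.exp_add]
    ring
  rw [volDensity, hdet, Real.sqrt_sq (by positivity)]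

theorem christoffel_staticMetric {α' β' : ℝ} (hc : c ≠ 0) (hx : radius x = r) (hr : 0 < r)
    (hα : HasDerivAt α α' r) (hβ : HasDerivAt β β' r) (k i j : Fin 4) :
    christoffel (staticMetric c α β) k i j x =
      connectionMatrix α' (c ^ 2 * α' * Real.exp (2 * α r - 2 * β r)) β'
        ((1 - Real.exp (-(2 * β r))) / r) x i k j := by
  rw [funext (staticMetric_eq_frameMatrix c α β), christoffel_frameMatrix hx hr
    ((hα.const_mul 2).exp.mul_const (c ^ 2)).fun_neg (hβ.const_mul 2).exp (by simp [hc])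
    (by simp), Real.exp_neg, Real.exp_sub]
  congr 1 <;> field

theorem hasDerivAt_deriv_of_contDiffOn {f : ℝ → ℝ} (hf : ContDiffOn ℝ 2 f (Set.Ioi 0))
    (hr : 0 < r) :
    HasDerivAt f (deriv f r) r ∧ HasDerivAt (deriv f) (deriv (deriv f) r) r := by
  have hf' : ContDiffOn ℝ 1 (deriv f) (Set.Ioi 0) := hf.deriv_of_isOpen isOpen_Ioi (by norm_num)
  have hmem : Set.Ioi 0 ∈ 𝓝 r := Ioi_mem_nhds hr
  exact ⟨((hf.differentiableOn two_ne_zero).differentiableAt hmem).hasDerivAt,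
    ((hf'.differentiableOn one_ne_zero).differentiableAt hmem).hasDerivAt⟩

theorem ricci_staticMetric (hc : c ≠ 0) (hα : ContDiffOn ℝ 2 α (Set.Ioi 0))
    (hβ : ContDiffOn ℝ 2 β (Set.Ioi 0)) (hx : radius x = r) (hr : 0 < r) (i j : Fin 4) :
    ricci (staticMetric c α β) i j x = frameMatrix
      (c ^ 2 * Real.exp (2 * α r - 2 * β r) * (deriv (deriv α) r + deriv α r ^ 2
        - deriv α r * deriv β r + 2 * deriv α r / r))
      (2 * deriv β r / r - deriv (deriv α) r + deriv α r * deriv β r - deriv α r ^ 2)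
      ((1 - Real.exp (-(2 * β r))) / r ^ 2
        + Real.exp (-(2 * β r)) * (deriv β r - deriv α r) / r) x i j := by
  obtain ⟨hα₁, hα₂⟩ := hasDerivAt_deriv_of_contDiffOn hα hr
  obtain ⟨hβ₁, hβ₂⟩ := hasDerivAt_deriv_of_contDiffOn hβ hr
  have hΓ := fun k i j y hy => christoffel_staticMetric (x := y) hc rfl hy
    (hasDerivAt_deriv_of_contDiffOn hα hy).1 (hasDerivAt_deriv_of_contDiffOn hβ hy).1 k i j
  have hB := (hα₂.const_mul (c ^ 2)).fun_mul ((hα₁.const_mul 2).fun_sub (hβ₁.const_mul 2)).exp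
  have hD := ((hβ₁.const_mul 2).fun_neg.exp.const_sub 1).fun_div (hasDerivAt_id' r) hr.ne'
  rw [ricci_of_christoffel_eq_connectionMatrix hx hr hΓ hα₂ hB hβ₂ hD]
  congr 1 <;> field

theorem einstein_staticMetric (hc : c ≠ 0) (hα : ContDiffOn ℝ 2 α (Set.Ioi 0))
    (hβ : ContDiffOn ℝ 2 β (Set.Ioi 0)) (hx : radius x = r) (hr : 0 < r) (μ ν : Fin 4) :
    einstein (staticMetric c α β) μ ν x = frameMatrix
      (Real.exp (-(2 * β r)) * (1 / r ^ 2 - 2 * deriv β r / r) - 1 / r ^ 2)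
      (Real.exp (-(2 * β r)) * (1 / r ^ 2 + 2 * deriv α r / r) - 1 / r ^ 2)
      (Real.exp (-(2 * β r)) * (deriv (deriv α) r + deriv α r ^ 2 - deriv α r * deriv β r
        + (deriv α r - deriv β r) / r)) x μ ν := by
  rw [einstein_of_ricci_eq_frameMatrix (hx ▸ hr) _ _ (staticMetric_eq_frameMatrix c α β x)
    (ricci_staticMetric hc hα hβ hx hr), hx, Real.exp_sub, Real.exp_neg]
  · congr 1 <;> field
  · simp [hc]
  · simp

end StaticMetric

section Contraction

variable {c r : ℝ} {α : ℝ → ℝ} {ψ : (Fin 4 → ℝ) → (Fin 4 → ℝ)} {x : Fin 4 → ℝ}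

/-- The function `E = (r (e^{2α} - 1))'`. It is `r² Gᵗₜ` for the metric with `β = -α`, and equals
`-(2 G / c²) m'` in terms of the cumulative mass `m`. -/
noncomputable def energyProfile (α : ℝ → ℝ) (r : ℝ) : ℝ :=
  Real.exp (2 * α r) * (1 + 2 * r * deriv α r) - 1

theorem hasDerivAt_energyProfile (hα : ContDiffOn ℝ 2 α (Set.Ioi 0)) (hr : 0 < r) :
    HasDerivAt (energyProfile α)
      (2 * Real.exp (2 * α r) * (r * deriv (deriv α) r + 2 * r * deriv α r ^ 2 + 2 * deriv α r))
      r := by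
  obtain ⟨hα₁, hα₂⟩ := hasDerivAt_deriv_of_contDiffOn hα hr
  have h := ((hα₁.const_mul 2).exp.mul
    ((((hasDerivAt_id' r).const_mul 2).mul hα₂).const_add 1)).sub_const 1
  refine h.congr_deriv ?_
  simp only [Pi.mul_apply]
  ring

theorem contDiffOn_energyProfile (hα : ContDiffOn ℝ 2 α (Set.Ioi 0)) :
    ContDiffOn ℝ 1 (energyProfile α) (Set.Ioi 0) := by
  have hα₁ : ContDiffOn ℝ 1 α (Set.Ioi 0) := hα.of_le (by norm_num)
  have hα' : ContDiffOn ℝ 1 (deriv α) (Set.Ioi 0) := hα.deriv_of_isOpen isOpen_Ioi (by norm_num)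
  unfold energyProfile
  fun_prop

theorem einstein_staticMetric_neg (hc : c ≠ 0) (hα : ContDiffOn ℝ 2 α (Set.Ioi 0))
    (hx : radius x = r) (hr : 0 < r) (μ ν : Fin 4) :
    einstein (staticMetric c α fun r => -α r) μ ν x =
      frameMatrix (energyProfile α r / r ^ 2) (energyProfile α r / r ^ 2)
        (deriv (energyProfile α) r / (2 * r)) x μ ν := by
  rw [einstein_staticMetric hc hα hα.neg hx hr, (hasDerivAt_energyProfile hα hr).deriv,
    deriv.fun_neg, energyProfile, mul_neg, neg_neg]
  congr 1 <;> field

theorem einstein_contraction_staticMetric_neg (hc : c ≠ 0) (hα : ContDiffOn ℝ 2 α (Set.Ioi 0))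
    (hx : radius x = r) (hr : 0 < r) (ψ : (Fin 4 → ℝ) → (Fin 4 → ℝ)) :
    (∑ μ, ∑ ν, einstein (staticMetric c α fun r => -α r) μ ν x *
        covDeriv (staticMetric c α fun r => -α r) ψ μ ν x) *
        volDensity (staticMetric c α fun r => -α r) x =
      |c| * ∑ μ, ∑ ν, frameMatrix (energyProfile α r / r ^ 2) (energyProfile α r / r ^ 2)
        (deriv (energyProfile α) r / (2 * r)) x μ ν * pderiv μ (fun y => ψ y ν) x := by
  have hα₁ := (hasDerivAt_deriv_of_contDiffOn hα hr).1
  simp only [einstein_staticMetric_neg hc hα hx hr]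
  rw [sum_frameMatrix_mul_covDeriv (hx ▸ hr) (christoffel_staticMetric hc hx hr hα₁ hα₁.fun_neg),
    volDensity_staticMetric (hx ▸ hr), add_neg_cancel, Real.exp_zero]
  ring

theorem contDiff_pderiv {u : (Fin 4 → ℝ) → ℝ} (hu : ContDiff ℝ ∞ u) (i : Fin 4) :
    ContDiff ℝ ∞ (pderiv i u) :=
  (hu.fderiv_right (m := ∞) (by simp)).clm_apply contDiff_const

theorem pderiv_comm {u : (Fin 4 → ℝ) → ℝ} (hu : ContDiff ℝ 2 u) (i j : Fin 4) (x : Fin 4 → ℝ) :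
    pderiv i (pderiv j u) x = pderiv j (pderiv i u) x := by
  have hd : DifferentiableAt ℝ (fderiv ℝ u) x :=
    (hu.fderiv_right (m := 1) (by norm_num)).differentiable one_ne_zero x
  have hsecond : ∀ i j, pderiv i (pderiv j u) x =
      fderiv ℝ (fderiv ℝ u) x (Pi.single i 1) (Pi.single j 1) := fun i j => by
    have h : HasFDerivAt (pderiv j u) _ x :=
      hd.hasFDerivAt.clm_apply (hasFDerivAt_const (Pi.single j (1 : ℝ) : Fin 4 → ℝ) x)
    rw [pderiv, h.fderiv]
    simp
  rw [hsecond, hsecond]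
  exact (hu.contDiffAt.isSymmSndFDerivAt (by simp)).eq _ _

theorem HasPartialsAt.of_contDiff {n : WithTop ℕ∞} {u : (Fin 4 → ℝ) → ℝ} (hu : ContDiff ℝ n u)
    (hn : n ≠ 0) (x : Fin 4 → ℝ) : HasPartialsAt u (fun i => pderiv i u x) x :=
  ⟨hu.differentiable hn x, fun _ => rfl⟩

/-- The vector field with time component `ψ⁰` and spatial components
`½ ∑ⱼ (xᵏ ∂ⱼ ψʲ - xʲ ∂ⱼ ψᵏ)`. For radial `Z`, the divergence of `Z · flux ψ` is the contraction of
`∂ψ` with the tensor `Z (dt² + dr²) + (Z + r Z' / 2) (dx² - dr²)`. -/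
noncomputable def flux (ψ : (Fin 4 → ℝ) → (Fin 4 → ℝ)) (x : Fin 4 → ℝ) : Fin 4 → ℝ :=
  Fin.cons (ψ x 0) fun k => (1 / 2) * ∑ j : Fin 3,
    (x k.succ * pderiv j.succ (fun y => ψ y j.succ) x
      - x j.succ * pderiv j.succ (fun y => ψ y k.succ) x)

theorem contDiff_flux (hψ : ContDiff ℝ ∞ ψ) : ContDiff ℝ ∞ (flux ψ) := by
  have hψ' : ∀ i j, ContDiff ℝ ∞ (pderiv i fun y => ψ y j) :=
    fun i j => contDiff_pderiv (contDiff_pi.1 hψ j) i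
  refine contDiff_pi.2 (Fin.cases (contDiff_pi.1 hψ 0) fun k => ?_)
  simp only [flux, Fin.cons_succ]
  fun_prop

theorem sum_pderiv_flux (hψ : ContDiff ℝ ∞ ψ) (x : Fin 4 → ℝ) :
    ∑ k, pderiv k (fun y => flux ψ y k) x = ∑ k, pderiv k (fun y => ψ y k) x := by
  set D : Fin 3 → Fin 3 → (Fin 4 → ℝ) → ℝ := fun i j => pderiv i.succ fun y => ψ y j.succ
  have hD : ∀ i j, HasPartialsAt (D i j) (fun l => pderiv l (D i j) x) x := fun i j =>
    .of_contDiff (contDiff_pderiv (contDiff_pi.1 hψ _) _) (by simp) x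
  have hcomm : ∀ i j k : Fin 3, pderiv i.succ (D j k) x = pderiv j.succ (D i k) x := fun i j k =>
    pderiv_comm (contDiff_infty.1 (contDiff_pi.1 hψ k.succ) 2) i.succ j.succ x
  have hterm : ∀ j k : Fin 3, HasPartialsAt
      (fun y => 1 / 2 * (y k.succ * D j j y - y j.succ * D j k y)) _ x := fun j k =>
    ((((HasPartialsAt.coord k.succ x).mul (hD j j)).mul (.const (1 / 2))).add
      (((HasPartialsAt.coord j.succ x).mul (hD j k)).mul (.const (-1 / 2)))
      ).congr_of_eventuallyEq (.of_forall fun y => by ring)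
  have hflux : ∀ k : Fin 3, pderiv k.succ (fun y => flux ψ y k.succ) x =
      ∑ j, (1 / 2 * (D j j x - (if j = k then D j k x else 0)) + 1 / 2 *
        (x k.succ * pderiv k.succ (D j j) x - x j.succ * pderiv k.succ (D j k) x)) := fun k => by
    simp only [flux, Fin.cons_succ, Finset.mul_sum]
    rw [pderiv_sum fun j _ => (hterm j k).differentiableAt]
    refine Finset.sum_congr rfl fun j _ => ((hterm j k).pderiv_eq _).trans ?_
    simp only [mul_zero, one_div, ↓reduceIte, mul_one, zero_add, Fin.succ_inj, eq_comm (a := k),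
      mul_ite]
    ring
  have hsecond : ∑ k : Fin 3, ∑ j : Fin 3, x j.succ * pderiv k.succ (D j k) x =
      ∑ k : Fin 3, ∑ j : Fin 3, x k.succ * pderiv k.succ (D j j) x := by
    rw [Finset.sum_comm]
    exact Finset.sum_congr rfl fun j _ => Finset.sum_congr rfl fun k _ => by rw [hcomm]
  have htrace : ∑ k, ∑ j, (if j = k then D j k x else 0) = ∑ k, D k k x := by simp
  rw [Fin.sum_univ_succ, Fin.sum_univ_succ (fun k => pderiv k (fun y => ψ y k) x)]
  simp only [hflux, Finset.sum_add_distrib, ← Finset.mul_sum, Finset.sum_sub_distrib, hsecond,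
    htrace, Finset.sum_const, Finset.card_univ, Fintype.card_fin, nsmul_eq_mul, sub_self,
    mul_zero, add_zero]
  simp only [flux, Fin.cons_zero]
  push_cast
  ring

theorem flux_succ (hx : 0 < radius x) (ψ : (Fin 4 → ℝ) → (Fin 4 → ℝ)) (k : Fin 3) :
    flux ψ x k.succ = radius x / 2 * ∑ j : Fin 3,
      (dr x k.succ * pderiv j.succ (fun y => ψ y j.succ) x
        - dr x j.succ * pderiv j.succ (fun y => ψ y k.succ) x) := by
  simp only [flux, Fin.cons_succ, ← radius_mul_dr hx (Fin.succ_ne_zero _), Finset.mul_sum]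
  exact Finset.sum_congr rfl fun j _ => by ring

theorem sum_dr_mul_flux (hx : 0 < radius x) (ψ : (Fin 4 → ℝ) → (Fin 4 → ℝ)) :
    ∑ k, dr x k * flux ψ x k =
      radius x / 2 * ∑ μ, ∑ ν, sphereProj x μ ν * pderiv μ (fun y => ψ y ν) x := by
  have hnn : ∑ k : Fin 3, dr x k.succ * dr x k.succ = 1 := by
    rw [← dr_dotProduct_dr hx, dotProduct, Fin.sum_univ_succ (n := 3), dr_time, zero_mul, zero_add]
  have hproj : ∀ j k : Fin 3, sphereProj x j.succ k.succ =
      (if j = k then 1 else 0) - dr x j.succ * dr x k.succ := fun j k => by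
    simp [sphereProj, euclid]
  have hproj₀ : ∀ j, sphereProj x j 0 = 0 := fun j => by rw [sphereProj_comm, sphereProj_time]
  simp only [Fin.sum_univ_succ (n := 3), dr_time, zero_mul, zero_add, flux_succ hx, hproj, hproj₀,
    sphereProj_time, Finset.sum_const_zero]
  set D : Fin 3 → Fin 3 → ℝ := fun j k => pderiv j.succ (fun y => ψ y k.succ) x
  calc ∑ k : Fin 3, dr x k.succ * (radius x / 2 *
        ∑ j : Fin 3, (dr x k.succ * D j j - dr x j.succ * D j k))
      = radius x / 2 * ((∑ k : Fin 3, dr x k.succ * dr x k.succ) * ∑ j, D j j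
          - ∑ j : Fin 3, ∑ k : Fin 3, dr x j.succ * dr x k.succ * D j k) := by
        simp only [Fin.sum_univ_three]; ring
    _ = radius x / 2 * ∑ j : Fin 3, ∑ k : Fin 3,
          ((if j = k then 1 else 0) - dr x j.succ * dr x k.succ) * D j k := by
        rw [hnn]; simp [sub_mul]

theorem sum_pderiv_radial_mul_flux {Z : ℝ → ℝ} {Z' : ℝ} (hψ : ContDiff ℝ ∞ ψ)
    (hx : radius x = r) (hr : 0 < r) (hZ : HasDerivAt Z Z' r) :
    ∑ k, pderiv k (fun y => Z (radius y) * flux ψ y k) x =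
      ∑ μ, ∑ ν, frameMatrix (Z r) (Z r) (Z r + r * Z' / 2) x μ ν *
        pderiv μ (fun y => ψ y ν) x := by
  have hZ_flux : ∀ k, pderiv k (fun y => Z (radius y) * flux ψ y k) x =
      Z r * pderiv k (fun y => flux ψ y k) x + Z' * (dr x k * flux ψ x k) := fun k => by
    rw [((HasPartialsAt.radial hx hr hZ).mul
      (.of_contDiff (contDiff_pi.1 (contDiff_flux hψ) k) (by simp) x)).pderiv_eq, hx]
    ring
  have hframe : frameMatrix (Z r) (Z r) (Z r + r * Z' / 2) x =
      Z r • 1 + (r * Z' / 2) • sphereProj x := by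
    rw [← frameMatrix_one (x := x), frameMatrix, frameMatrix]; module
  have htrace : ∑ μ, ∑ ν, (1 : Matrix (Fin 4) (Fin 4) ℝ) μ ν * pderiv μ (fun y => ψ y ν) x =
      ∑ k, pderiv k (fun y => ψ y k) x := by simp [Matrix.one_apply]
  simp only [hZ_flux, hframe, Finset.sum_add_distrib, ← Finset.mul_sum, sum_pderiv_flux hψ,
    sum_dr_mul_flux (hx ▸ hr), hx, Matrix.add_apply, Matrix.smul_apply, smul_eq_mul, add_mul,
    mul_assoc, htrace]
  ring

end Contraction

section RadialIntegrability

open MeasureTheory Set Module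

variable {h : ℝ → ℝ} {a : ℝ}

theorem integrableOn_pow_mul_of_isBigO (hh : ContinuousOn h (Ioi 0))
    (ho : h =O[𝓝[>] 0] (· ^ a)) {n : ℕ} (ha : -(n + 1) < a) (R : ℝ) :
    IntegrableOn (fun r => r ^ n * h r) (Ioo 0 R) := by
  obtain ⟨ε, hε, hint⟩ := mellin_convergent_zero_of_isBigO (b := -a) (s := n + 1)
    (hh.aestronglyMeasurable measurableSet_Ioi) (by simpa using! ho) (by linarith)
  have hnear : IntegrableOn (fun r => r ^ n * h r) (Ioc 0 ε) := by simpa using! hint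
  have hfar : IntegrableOn (fun r => r ^ n * h r) (Icc ε R) :=
    (((continuous_pow n).continuousOn.mul hh).mono fun r hr => hε.trans_le hr.1
      ).integrableOn_Icc
  refine (hnear.union hfar).mono_set fun r hr => ?_
  obtain hrε | hrε := le_total r ε
  · exact .inl ⟨hr.1, hrε⟩
  · exact .inr ⟨hrε, hr.2.le⟩

theorem integrableOn_ball_of_isBigO {E : Type*} [NormedAddCommGroup E] [NormedSpace ℝ E]
    [FiniteDimensional ℝ E] [Nontrivial E] [MeasurableSpace E] [BorelSpace E] (ν : Measure E)
    [ν.IsAddHaarMeasure] (hh : ContinuousOn h (Ioi 0)) (ho : h =O[𝓝[>] 0] (· ^ a))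
    (ha : -(finrank ℝ E : ℝ) < a) (R : ℝ) :
    IntegrableOn (fun x => h ‖x‖) (Metric.ball (0 : E) R) ν := by
  refine (integrableOn_fun_norm_addHaar ν).2 (integrableOn_pow_mul_of_isBigO hh ho ?_ R)
  rwa [Nat.cast_sub finrank_pos, Nat.cast_one, sub_add_cancel]

theorem integrableOn_radial_of_isBigO (hh : ContinuousOn h (Ioi 0))
    (ho : h =O[𝓝[>] 0] (· ^ a)) (ha : -3 < a) {K : Set (Fin 4 → ℝ)} (hK : IsCompact K) :
    IntegrableOn (fun x => h (radius x)) K := by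
  obtain ⟨R, hR⟩ := hK.isBounded.subset_ball 0
  obtain ⟨S, hS⟩ := (hK.image continuous_radius).isBounded.subset_ball 0
  let e : (Fin 4 → ℝ) ≃ᵐ ℝ × EuclideanSpace ℝ (Fin 3) :=
    (MeasurableEquiv.piFinSuccAbove (fun _ => ℝ) 0).trans
      ((MeasurableEquiv.refl ℝ).prodCongr (MeasurableEquiv.toLp 2 (Fin 3 → ℝ)))
  have he : MeasurePreserving e := ((MeasurePreserving.id volume).prod
    (PiLp.volume_preserving_toLp (Fin 3))).comp
      (volume_preserving_piFinSuccAbove (fun _ : Fin 4 => ℝ) 0)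
  have hradius : ∀ x, ‖(e x).2‖ = radius x := fun x => by
    rw [EuclideanSpace.norm_eq, radius, Fin.sum_univ_three]
    simp only [Real.norm_eq_abs, sq_abs]
    rfl
  have hprod : IntegrableOn (fun p : ℝ × EuclideanSpace ℝ (Fin 3) => h ‖p.2‖)
      (Ioo (-R) R ×ˢ Metric.ball 0 S) := by
    rw [IntegrableOn, Measure.volume_eq_prod, ← Measure.prod_restrict]
    exact (integrableOn_ball_of_isBigO volume hh ho (by simpa using ha) S).comp_snd _
  have hcomp := (he.integrableOn_comp_preimage e.measurableEmbedding).2 hprod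
  simp only [Function.comp_def, hradius] at hcomp
  refine hcomp.mono_set fun x hx => ⟨?_, ?_⟩
  · exact abs_lt.1 ((norm_le_pi_norm x 0).trans_lt (mem_ball_zero_iff.1 (hR hx)))
  · rw [mem_ball_zero_iff, hradius]
    exact (le_abs_self _).trans_lt (mem_ball_zero_iff.1 (hS (mem_image_of_mem _ hx)))

theorem integrable_radial_mul (hh : ContinuousOn h (Ioi 0)) (ho : h =O[𝓝[>] 0] (· ^ a))
    (ha : -3 < a) {w : (Fin 4 → ℝ) → ℝ} {C : ℝ} (hw : AEStronglyMeasurable w)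
    (hC : ∀ᵐ x, |w x| ≤ C) (hs : HasCompactSupport w) :
    Integrable fun x => h (radius x) * w x := by
  refine (integrableOn_iff_integrable_of_support_subset (s := tsupport w) ?_).1
    ((integrableOn_radial_of_isBigO hh ho ha hs).mul_bdd hw.restrict (ae_restrict_of_ae hC))
  exact (Function.support_mul_subset_right _ _).trans (subset_tsupport w)

end RadialIntegrability

section Fubini

open MeasureTheory

theorem integral_eq_zero_of_hasDerivAt_insertNth {n : ℕ} (k : Fin (n + 1))
    {u u' : (Fin (n + 1) → ℝ) → ℝ} (hu : Integrable u) (hu' : Integrable u')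
    (h : ∀ᵐ y : Fin n → ℝ, ∀ t,
      HasDerivAt (fun s => u (k.insertNth s y)) (u' (k.insertNth t y)) t) :
    ∫ x, u' x = 0 := by
  have e := (volume_preserving_piFinSuccAbove (fun _ : Fin (n + 1) => ℝ) k).symm
  have hmeas :=
    (MeasurableEquiv.piFinSuccAbove (fun _ : Fin (n + 1) => ℝ) k).symm.measurableEmbedding
  have hi := (e.integrable_comp_emb hmeas).2 hu
  have hi' := (e.integrable_comp_emb hmeas).2 hu'
  rw [← e.integral_comp hmeas]
  refine (integral_prod_symm _ hi').trans (integral_eq_zero_of_ae ?_)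
  filter_upwards [h, hi.prod_left_ae, hi'.prod_left_ae] with y hy hy₁ hy₂
  exact integral_eq_zero_of_hasDerivAt_of_integrable hy hy₂ hy₁

theorem HasPartialsAt.hasDerivAt_insertNth {f : (Fin 4 → ℝ) → ℝ} {v : Fin 4 → ℝ} {k : Fin 4}
    {t : ℝ} {y : Fin 3 → ℝ} (hf : HasPartialsAt f v (k.insertNth t y)) :
    HasDerivAt (fun s => f (k.insertNth s y)) (v k) t := by
  have hline : HasDerivAt (fun s => (k.insertNth s y : Fin 4 → ℝ)) (Pi.single k 1) t :=
    (hasDerivAt_update (k.insertNth t y : Fin 4 → ℝ) k t).congr_of_eventuallyEq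
      (.of_forall fun s => (Fin.update_insertNth (α := fun _ => ℝ) k t s y).symm)
  rw [← hf.pderiv_eq]
  exact hf.differentiableAt.hasFDerivAt.comp_hasDerivAt t hline

theorem radius_pos_of_ne {x : Fin 4 → ℝ} {i : Fin 4} (hi : i ≠ 0) (hx : x i ≠ 0) :
    0 < radius x := by
  refine Real.sqrt_pos.2 ?_
  have := sq_pos_of_ne_zero hx
  fin_cases i
  · exact absurd rfl hi
  all_goals simp only at this; positivity

theorem ae_radius_pos : ∀ᵐ x, 0 < radius x :=
  (Measure.ae_eval_ne (fun _ => volume) 1 0).mono fun _ hx => radius_pos_of_ne one_ne_zero hx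

theorem ae_forall_radius_insertNth_pos (k : Fin 4) :
    ∀ᵐ y : Fin 3 → ℝ, ∀ t, 0 < radius (k.insertNth t y) := by
  filter_upwards [Measure.ae_eval_ne (fun _ => volume) 2 0] with y hy t
  refine radius_pos_of_ne (i := k.succAbove 2) ?_ (by simpa using hy)
  fin_cases k <;> decide

end Fubini

section Divergence

open MeasureTheory Set

variable {Z : ℝ → ℝ} {a : ℝ}

theorem measurable_dr (k : Fin 4) : Measurable fun x => dr x k := by
  have := continuous_radius.measurable
  unfold dr
  split_ifs <;> fun_prop

theorem integrable_pderiv_radial_mul (hZ : ContDiffOn ℝ 1 Z (Ioi 0))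
    (ho : Z =O[𝓝[>] 0] (· ^ a)) (ho' : (fun r => r * deriv Z r) =O[𝓝[>] 0] (· ^ a))
    (ha : -3 < a) {f : (Fin 4 → ℝ) → ℝ} (hf : ContDiff ℝ 1 f) (hs : HasCompactSupport f)
    {k : Fin 4} {C : ℝ} (hC : ∀ x, 0 < radius x → |dr x k * f x| ≤ C * radius x) :
    Integrable (pderiv k fun y => Z (radius y) * f y) := by
  have hZ' : ContinuousOn (fun r => r * deriv Z r) (Ioi 0) :=
    continuousOn_id.mul (hZ.continuousOn_deriv_of_isOpen isOpen_Ioi le_rfl)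
  have hpf : Continuous (pderiv k f) := (hf.continuous_fderiv one_ne_zero).clm_apply
    continuous_const
  have hps : HasCompactSupport (pderiv k f) := hs.fderiv_apply ℝ _
  obtain ⟨B, hB⟩ := hpf.bounded_above_of_compact_support hps
  have hbound : ∀ᵐ x, |dr x k / radius x * f x| ≤ C := ae_radius_pos.mono fun x hx => by
    rw [div_mul_eq_mul_div, abs_div, abs_of_pos hx, div_le_iff₀ hx]
    exact hC x hx
  have hmeas : Measurable fun x => dr x k / radius x * f x :=
    ((measurable_dr k).div continuous_radius.measurable).mul hf.continuous.measurable
  refine ((integrable_radial_mul hZ.continuousOn ho ha hpf.aestronglyMeasurable (.of_forall hB)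
    hps).add (integrable_radial_mul hZ' ho' ha hmeas.aestronglyMeasurable hbound
      hs.mul_left)).congr (ae_radius_pos.mono fun x hx => ?_)
  have hZx : HasDerivAt Z (deriv Z (radius x)) (radius x) :=
    ((hZ.differentiableOn one_ne_zero).differentiableAt (Ioi_mem_nhds hx)).hasDerivAt
  rw [((HasPartialsAt.radial rfl hx hZx).mul (.of_contDiff hf one_ne_zero x)).pderiv_eq]
  simp only [Pi.add_apply]
  field

theorem integral_pderiv_radial_mul (hZ : ContDiffOn ℝ 1 Z (Ioi 0))
    (ho : Z =O[𝓝[>] 0] (· ^ a)) (ha : -3 < a) {f : (Fin 4 → ℝ) → ℝ} (hf : ContDiff ℝ 1 f)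
    (hs : HasCompactSupport f) {k : Fin 4}
    (hi : Integrable (pderiv k fun y => Z (radius y) * f y)) :
    ∫ x, pderiv k (fun y => Z (radius y) * f y) x = 0 := by
  obtain ⟨B, hB⟩ := hf.continuous.bounded_above_of_compact_support hs
  refine integral_eq_zero_of_hasDerivAt_insertNth k (integrable_radial_mul hZ.continuousOn ho ha
    hf.continuous.aestronglyMeasurable (.of_forall hB) hs) hi ?_
  filter_upwards [ae_forall_radius_insertNth_pos k] with y hy t
  have hZt := ((hZ.differentiableOn one_ne_zero).differentiableAt
    (Ioi_mem_nhds (hy t))).hasDerivAt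
  have h := (HasPartialsAt.radial rfl (hy t) hZt).mul (.of_contDiff hf one_ne_zero _)
  exact h.hasDerivAt_insertNth.congr_deriv (h.pderiv_eq k).symm

end Divergence

section FluxBounds

variable {ψ : (Fin 4 → ℝ) → (Fin 4 → ℝ)}

theorem abs_dr_le_one {x : Fin 4 → ℝ} (hx : 0 < radius x) (k : Fin 4) : |dr x k| ≤ 1 := by
  have := sum_dr_sq hx
  rw [← sq_le_one_iff_abs_le_one]
  fin_cases k <;> simp only [Fin.zero_eta, Fin.mk_one, Fin.reduceFinMk, dr_time] <;> nlinarith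

theorem hasCompactSupport_flux (hs : HasCompactSupport ψ) (k : Fin 4) :
    HasCompactSupport fun x => flux ψ x k := by
  refine .intro hs fun x hx => ?_
  have h₀ := notMem_tsupport_iff_eventuallyEq.1 hx
  have hpd : ∀ i j, pderiv i (fun y => ψ y j) x = 0 := fun i j => by
    have hj : (fun y => ψ y j) =ᶠ[𝓝 x] fun _ => 0 := h₀.mono fun y hy => congrFun hy j
    rw [pderiv, hj.fderiv_eq]
    simp
  refine Fin.cases (congrFun h₀.eq_of_nhds 0) (fun k => ?_) k
  simp only [flux, Fin.cons_succ, hpd, mul_zero, sub_zero, Finset.sum_const_zero]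

theorem exists_abs_dr_mul_flux_le (hψ : ContDiff ℝ ∞ ψ) (hs : HasCompactSupport ψ) (k : Fin 4) :
    ∃ C, ∀ x, 0 < radius x → |dr x k * flux ψ x k| ≤ C * radius x := by
  have hbound : ∀ i j, ∃ B, ∀ x, |pderiv i (fun y => ψ y j) x| ≤ B := fun i j =>
    (contDiff_pderiv (contDiff_pi.1 hψ j) i).continuous.bounded_above_of_compact_support
      ((hs.comp_left (g := fun v : Fin 4 → ℝ => v j) rfl).fderiv_apply ℝ _)
  choose B hB using hbound
  refine Fin.cases ⟨0, fun x _ => by simp [dr_time]⟩ (fun k => ?_) k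
  refine ⟨1 / 2 * ∑ j : Fin 3, (B j.succ j.succ + B j.succ k.succ), fun x hx => ?_⟩
  have hdr_mul : ∀ i v, |dr x i * v| ≤ |v| := fun i v => by
    rw [abs_mul]
    exact mul_le_of_le_one_left (abs_nonneg v) (abs_dr_le_one hx i)
  calc |dr x k.succ * flux ψ x k.succ|
      ≤ |flux ψ x k.succ| := hdr_mul _ _
    _ ≤ radius x / 2 * ∑ j : Fin 3, (B j.succ j.succ + B j.succ k.succ) := by
        rw [flux_succ hx, abs_mul, abs_of_pos (half_pos hx)]
        gcongr
        refine (Finset.abs_sum_le_sum_abs _ _).trans (Finset.sum_le_sum fun j _ => ?_)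
        exact (abs_sub _ _).trans (add_le_add ((hdr_mul _ _).trans (hB _ _ x))
          ((hdr_mul _ _).trans (hB _ _ x)))
    _ = _ := by ring

end FluxBounds

section Decay

open Set Asymptotics

variable {f : ℝ → ℝ} {a r : ℝ}

theorem IsBigOWithDerivs.isBigO {j k : ℕ} (h : IsBigOWithDerivs k f a) (hj : j ≤ k) :
    iteratedDeriv j f =O[𝓝[>] 0] fun r : ℝ => r ^ (a - j) := by
  refine ((h j hj).mul (isBigO_refl (fun r : ℝ => r ^ (a - j)) _)).congr' ?_ (by simp)
  filter_upwards [self_mem_nhdsWithin] with r (hr : 0 < r)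
  rw [mul_right_comm, ← Real.rpow_add hr, add_comm, sub_add_sub_cancel', sub_self,
    Real.rpow_zero, one_mul]

theorem IsBigOWithDerivs.congr_const_mul {k : ℕ} {g : ℝ → ℝ} {b : ℝ}
    (h : IsBigOWithDerivs k f a) (hfg : ∀ r, 0 < r → g r = b * f r) :
    IsBigOWithDerivs k g a := by
  intro j hj
  refine ((h j hj).const_mul_left b).congr' ?_ .rfl
  filter_upwards [self_mem_nhdsWithin] with r hr
  have hg : g =ᶠ[𝓝 r] fun s => b * f s := (lt_mem_nhds hr).mono fun s hs => hfg s hs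
  rw [hg.iteratedDeriv_eq, iteratedDeriv_const_mul_field]
  ring

theorem hasDerivAt_div_sq {f' : ℝ} (hf : HasDerivAt f f' r) (hr : 0 < r) :
    HasDerivAt (fun s => f s / s ^ 2) (f' / r ^ 2 - 2 * (f r / r ^ 3)) r := by
  refine (hf.div (hasDerivAt_pow 2 r) (by positivity)).congr_deriv ?_
  field

theorem isBigO_div_pow (hf : f =O[𝓝[>] 0] (· ^ a)) (n : ℕ) :
    (fun r => f r / r ^ n) =O[𝓝[>] 0] (· ^ (a - n)) := by
  refine (hf.mul (isBigO_refl (fun r : ℝ => (r ^ n)⁻¹) _)).congr' ?_ ?_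
  · exact .of_forall fun r => (div_eq_mul_inv _ _).symm
  · filter_upwards [self_mem_nhdsWithin] with r (hr : 0 < r)
    rw [Real.rpow_sub_natCast hr.ne', div_eq_mul_inv]

theorem IsBigOWithDerivs.isBigO_div_sq {k : ℕ} (h : IsBigOWithDerivs k f a) :
    (fun r => f r / r ^ 2) =O[𝓝[>] 0] (· ^ (a - 2)) := by
  simpa using! isBigO_div_pow (h.isBigO k.zero_le) 2

theorem IsBigOWithDerivs.isBigO_mul_deriv_div_sq (h : IsBigOWithDerivs 1 f a)
    (hf : DifferentiableOn ℝ f (Ioi 0)) :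
    (fun r => r * deriv (fun s => f s / s ^ 2) r) =O[𝓝[>] 0] (· ^ (a - 2)) := by
  have h' : (fun r => deriv f r / r) =O[𝓝[>] 0] (· ^ (a - 2)) := by
    have h₁ := isBigO_div_pow (h.isBigO le_rfl) 1
    simp only [iteratedDeriv_one, pow_one, Nat.cast_one, sub_sub, one_add_one_eq_two] at h₁
    exact h₁
  refine (h'.sub (h.isBigO_div_sq.const_mul_left 2)).congr' ?_ .rfl
  filter_upwards [self_mem_nhdsWithin] with r (hr : 0 < r)
  rw [(hasDerivAt_div_sq (hf.differentiableAt (Ioi_mem_nhds hr)).hasDerivAt hr).deriv]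
  field

end Decay

section WeakBianchi

open MeasureTheory Set

variable {c : ℝ} {α : ℝ → ℝ}

theorem einstein_contraction_eq_sum_pderiv_flux (hc : c ≠ 0) (hα : ContDiffOn ℝ 2 α (Ioi 0))
    {ψ : (Fin 4 → ℝ) → (Fin 4 → ℝ)} (hψ : ContDiff ℝ ∞ ψ) {x : Fin 4 → ℝ} (hx : 0 < radius x) :
    (∑ μ, ∑ ν, einstein (staticMetric c α fun r => -α r) μ ν x *
        covDeriv (staticMetric c α fun r => -α r) ψ μ ν x) *
        volDensity (staticMetric c α fun r => -α r) x =
      |c| * ∑ k, pderiv k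
        (fun y => energyProfile α (radius y) / radius y ^ 2 * flux ψ y k) x := by
  have hE := (hasDerivAt_energyProfile hα hx).differentiableAt.hasDerivAt
  rw [einstein_contraction_staticMetric_neg hc hα rfl hx,
    sum_pderiv_radial_mul_flux hψ rfl hx (hasDerivAt_div_sq hE hx)]
  have hangular : energyProfile α (radius x) / radius x ^ 2
      + radius x * (deriv (energyProfile α) (radius x) / radius x ^ 2
        - 2 * (energyProfile α (radius x) / radius x ^ 3)) / 2 =
      deriv (energyProfile α) (radius x) / (2 * radius x) := by field
  rw [hangular]

theorem weakSecondBianchi_staticMetric (hc : c ≠ 0) (hα : ContDiffOn ℝ 2 α (Ioi 0)) {γ : ℝ}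
    (hγ : 0 < γ) (hdecay : IsBigOWithDerivs 1 (energyProfile α) (-1 + γ)) :
    WeakSecondBianchi (staticMetric c α fun r => -α r) := by
  intro ψ hψ hs
  have hE := contDiffOn_energyProfile hα
  have hZ : ContDiffOn ℝ 1 (fun r => energyProfile α r / r ^ 2) (Ioi 0) :=
    hE.div (by fun_prop) fun r (hr : 0 < r) => by positivity
  have hZ₀ := hdecay.isBigO_div_sq
  have hZ₁ := hdecay.isBigO_mul_deriv_div_sq (hE.differentiableOn one_ne_zero)
  have hexp : -3 < -1 + γ - 2 := by linarith
  have hF : ∀ k, ContDiff ℝ 1 fun y => flux ψ y k := fun k =>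
    contDiff_infty.1 (contDiff_pi.1 (contDiff_flux hψ) k) 1
  have hFs := hasCompactSupport_flux hs
  have hint : ∀ k, Integrable (pderiv k
      fun y => energyProfile α (radius y) / radius y ^ 2 * flux ψ y k) := fun k => by
    obtain ⟨C, hC⟩ := exists_abs_dr_mul_flux_le hψ hs k
    exact integrable_pderiv_radial_mul hZ hZ₀ hZ₁ hexp (hF k) (hFs k) hC
  have hae : (fun x => |c| * ∑ k, pderiv k
      (fun y => energyProfile α (radius y) / radius y ^ 2 * flux ψ y k) x) =ᵐ[volume] _ :=
    ae_radius_pos.mono fun x hx => (einstein_contraction_eq_sum_pderiv_flux hc hα hψ hx).symm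
  refine ⟨((integrable_finsetSum _ fun k _ => hint k).const_mul |c|).congr hae, ?_⟩
  rw [← integral_congr_ae hae, integral_const_mul, integral_finsetSum _ fun k _ => hint k,
    Finset.sum_eq_zero fun k _ =>
      integral_pderiv_radial_mul hZ hZ₀ hexp (hF k) (hFs k) (hint k), mul_zero]

theorem hasDerivAt_mul_exp_sub_one {r : ℝ} (hα : DifferentiableAt ℝ α r) :
    HasDerivAt (fun s => s * (Real.exp (2 * α s) - 1)) (energyProfile α r) r := by
  refine ((hasDerivAt_id' r).mul
    ((hα.hasDerivAt.const_mul 2).exp.sub_const 1)).congr_deriv ?_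
  rw [energyProfile]
  ring

theorem energyProfile_eq_mul_deriv {m : ℝ → ℝ} {b r : ℝ} (hα : DifferentiableAt ℝ α r)
    (hm : ∀ s, 0 < s → s * (Real.exp (2 * α s) - 1) = b * m s) (hr : 0 < r) :
    energyProfile α r = b * deriv m r := by
  have hmass : (fun s => s * (Real.exp (2 * α s) - 1)) =ᶠ[𝓝 r] fun s => b * m s :=
    (lt_mem_nhds hr).mono hm
  rw [← (hasDerivAt_mul_exp_sub_one hα).deriv, hmass.deriv_eq, deriv_const_mul_field]

end WeakBianchi

end LorentzR4

theorem corollary2p4 (G c : ℝ) (hG : 0 < G) (hc : 0 < c) (α m : ℝ → ℝ)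
    (hα : ContDiffOn ℝ 2 α (Set.Ioi 0))
    (hm : ∀ r : ℝ, 0 < r → Real.exp (2 * α r) = 1 - 2 * G * m r / (c ^ 2 * r))
    (γ : ℝ) (hγ : 0 < γ)
    (hdecay : LorentzR4.IsBigOWithDerivs 1 (deriv m) (-1 + γ)) :
    LorentzR4.WeakSecondBianchi (LorentzR4.staticMetric c α (fun r => -α r)) := by
  have hmass : ∀ r, 0 < r → r * (Real.exp (2 * α r) - 1) = -(2 * G / c ^ 2) * m r :=
    fun r hr => by rw [hm r hr]; field
  exact LorentzR4.weakSecondBianchi_staticMetric hc.ne' hα hγ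
    (hdecay.congr_const_mul fun r hr => LorentzR4.energyProfile_eq_mul_deriv
      ((hα.differentiableOn two_ne_zero).differentiableAt (Ioi_mem_nhds hr)) hmass hr)
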